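/- For $x,y\in\{0,1\}^n$ let $|x|$ denote the Hamming weight and $\Delta(x,y)$ the Hamming distance. For integers $n,a,b\ge 0$, $c$ and $g\ge 1$ let $\mathrm{GHD}^n_{a,b,c,g}$ be the partial function on $\{0,1\}^n\times\{0,1\}^n$ that equals $1$ if $|x|=a$, $|y|=b$ and $\Delta(x,y)\ge c+g$, equals $0$ if $|x|=a$, $|y|=b$ and $\Delta(x,y)\le c-g$, and is undefined otherwise. For a partial function $f$ let $R(f)$ be the minimum, over all two-party (two-way) communication protocols with public randomness that output the correct value with probability at least $2/3$ on every input pair on which $f$ is defined, of the worst-case number of bits exchanged. There is an absolute constant $C>0$ such that for all integers $0\le a\le b\le n/2$, all integers $c$ and all integers $g\ge 1$, $$R(\mathrm{GHD}^n_{a,b,c,g})\;\le\; C\left(\Big(\frac{a}{g}\Big)^2\Big(\log_2\frac{b}{a}+\log_2\frac{a}{g}\Big)+1\right)$$ (for $a=0$ the product on the right is read as $0$), and $$R(\mathrm{GHD}^n_{a,b,c,g})\;\le\; C\,\min\left\{\Big(\frac{c}{g}\Big)^2,\Big(\frac{n-c}{g}\Big)^2\right\}.$$ -/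

import Mathlib

open scoped ENNReal

/-- A deterministic two-party communication protocol in which Alice holds an input in `X` and Bob
an input in `Y`, with outputs in `Z`: a finite binary tree. At an `alice` node Alice sends the bit
`q x`, at a `bob` node Bob sends the bit `q y`; the protocol continues in the first subtree if the
bit is `false` and in the second one if it is `true`. A leaf carries the output. -/
inductive DetProtocol (X Y Z : Type) : Type
  | leaf (z : Z) : DetProtocol X Y Z
  | alice (q : X → Bool) (P₀ P₁ : DetProtocol X Y Z) : DetProtocol X Y Z
  | bob (q : Y → Bool) (P₀ P₁ : DetProtocol X Y Z) : DetProtocol X Y Z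

namespace DetProtocol

variable {X Y Z : Type}

/-- The output of the protocol on the input pair `(x, y)`. -/
def run : DetProtocol X Y Z → X → Y → Z
  | leaf z, _, _ => z
  | alice q P₀ P₁, x, y => if q x then P₁.run x y else P₀.run x y
  | bob q P₀ P₁, x, y => if q y then P₁.run x y else P₀.run x y

/-- The cost of a deterministic protocol: the height of the tree, that is, the largest number of
bits exchanged. -/
def depth : DetProtocol X Y Z → ℕ
  | leaf _ => 0
  | alice _ P₀ P₁ => max P₀.depth P₁.depth + 1
  | bob _ P₀ P₁ => max P₀.depth P₁.depth + 1

end DetProtocol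

/-- A randomized protocol with public randomness: a probability distribution over deterministic
protocols (the shared random string selects the deterministic protocol that is run). -/
abbrev PublicCoinProtocol (X Y Z : Type) : Type := PMF (DetProtocol X Y Z)

namespace PublicCoinProtocol

variable {X Y Z : Type}

/-- The distribution of the output of a public-coin protocol on the input pair `(x, y)`. -/
noncomputable def output (π : PublicCoinProtocol X Y Z) (x : X) (y : Y) : PMF Z :=
  PMF.map (fun P => P.run x y) π

/-- The communication cost of a public-coin protocol: the largest number of bits exchanged, in the
worst case over the public randomness. -/
noncomputable def cost (π : PublicCoinProtocol X Y Z) : ℕ∞ :=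
  ⨆ P ∈ π.support, (P.depth : ℕ∞)

/-- The protocol computes the partial function `f` (where `none` stands for "undefined"): on every
input pair on which `f` is defined the output is correct with probability at least `2/3`. -/
def Computes (π : PublicCoinProtocol X Y Z) (f : X → Y → Option Z) : Prop :=
  ∀ x y z, f x y = some z → (2 / 3 : ℝ≥0∞) ≤ π.output x y z

end PublicCoinProtocol

/-- The randomized public-coin communication complexity of a partial function: the smallest cost of
a public-coin protocol that computes it. For finite `X` and `Y` the minimum is attained, see
`randCC_attained`. -/
noncomputable def randCC {X Y Z : Type} (f : X → Y → Option Z) : ℕ :=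
  sInf {k : ℕ | ∃ π : PublicCoinProtocol X Y Z, π.Computes f ∧ π.cost ≤ (k : ℕ∞)}

/-- Every function on finite sets has a deterministic protocol. -/
theorem DetProtocol.exists_run_eq {X Y Z : Type} [Finite X] [Finite Y] [Nonempty Z]
    (F : X → Y → Z) : ∃ P : DetProtocol X Y Z, ∀ x y, P.run x y = F x y := by
  classical
  obtain ⟨z₀⟩ := ‹Nonempty Z›
  have hbob : ∀ (G : Y → Z) (l : List Y),
      ∃ P : DetProtocol X Y Z, ∀ x, ∀ y ∈ l, P.run x y = G y := by
    intro G l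
    induction l with
    | nil => exact ⟨.leaf z₀, by simp⟩
    | cons y₀ l ih =>
      obtain ⟨P, hP⟩ := ih
      refine ⟨.bob (fun y => decide (y = y₀)) P (.leaf (G y₀)), fun x y hy => ?_⟩
      by_cases h : y = y₀
      · simp [DetProtocol.run, h]
      · have hy' : y ∈ l := by simpa [h] using hy
        simp [DetProtocol.run, h, hP x y hy']
  have halice : ∀ l : List X,
      ∃ P : DetProtocol X Y Z, ∀ x ∈ l, ∀ y, P.run x y = F x y := by
    intro l
    induction l with
    | nil => exact ⟨.leaf z₀, by simp⟩
    | cons x₀ l ih =>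
      obtain ⟨P, hP⟩ := ih
      have := Fintype.ofFinite Y
      obtain ⟨Q, hQ⟩ := hbob (F x₀) (Finset.univ : Finset Y).toList
      refine ⟨.alice (fun x => decide (x = x₀)) P Q, fun x hx y => ?_⟩
      by_cases h : x = x₀
      · simp [DetProtocol.run, h, hQ x₀ y (by simp)]
      · have hx' : x ∈ l := by simpa [h] using hx
        simp [DetProtocol.run, h, hP x hx' y]
  have := Fintype.ofFinite X
  obtain ⟨P, hP⟩ := halice (Finset.univ : Finset X).toList
  exact ⟨P, fun x y => hP x (by simp) y⟩

/-- The minimum in the definition of `randCC` is attained. -/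
theorem randCC_attained {X Y Z : Type} [Finite X] [Finite Y] [Nonempty Z]
    (f : X → Y → Option Z) :
    ∃ π : PublicCoinProtocol X Y Z, π.Computes f ∧ π.cost = (randCC f : ℕ∞) := by
  classical
  obtain ⟨z₀⟩ := ‹Nonempty Z›
  have : Nonempty Z := ⟨z₀⟩
  obtain ⟨P, hP⟩ := DetProtocol.exists_run_eq (fun x y => (f x y).getD z₀)
  have hne : {k : ℕ | ∃ π : PublicCoinProtocol X Y Z,
      π.Computes f ∧ π.cost ≤ (k : ℕ∞)}.Nonempty := by
    refine ⟨P.depth, PMF.pure P, ?_, ?_⟩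
    · intro x y z h
      have h1 : P.run x y = z := by rw [hP, h]; rfl
      have h2 : (2 / 3 : ℝ≥0∞) ≤ 1 :=
        ENNReal.div_le_of_le_mul (by norm_num)
      simpa [PublicCoinProtocol.output, PMF.pure_map, h1] using h2
    · simp [PublicCoinProtocol.cost]
  obtain ⟨π, hc, hk⟩ := Nat.sInf_mem hne
  refine ⟨π, hc, le_antisymm hk ?_⟩
  obtain ⟨m, hm⟩ := ENat.ne_top_iff_exists.mp (ne_top_of_le_ne_top (ENat.natCast_ne_top _) hk)
  rw [← hm]
  have hle : randCC f ≤ m := Nat.sInf_le ⟨π, hc, hm.symm.le⟩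
  exact_mod_cast hle

/-- The Hamming weight of a binary string. -/
def hammingWeight {n : ℕ} (x : Fin n → Bool) : ℕ :=
  (Finset.univ.filter fun i => x i = true).card

/-- The partial function Gap-Hamming-Distance: on strings of weights `a` and `b` it is `1` (`true`)
if the Hamming distance is at least `c + g`, and `0` (`false`) if it is at most `c - g`; it is
undefined (`none`) otherwise. -/
def GHD (n a b : ℕ) (c g : ℤ) (x y : Fin n → Bool) : Option Bool :=
  if hammingWeight x = a ∧ hammingWeight y = b then
    if c + g ≤ (hammingDist x y : ℤ) then some true
    else if (hammingDist x y : ℤ) ≤ c - g then some false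
    else none
  else none

/-!
A round in which Alice sends `s` bits to Bob, and whose acceptance probability separates the two
values of the function by `η`, becomes a correct protocol with `O(s / η²)` bits: repeat it in
parallel and threshold the number of acceptances, using Chebyshev's inequality.

For the bound in terms of `c`, the round compares the parities of `x` and `y` on a public random
sample of density of order `1 / c`; at distances near `c` this gives `η` of order `g / c`.
Replacing `y` by its complement turns distance `d` into `n - d`, hence the bound in terms of
`n - c`.

For the bound in terms of the weights, `Δ(x, y) = 2 |x \ y| + b - a`, so it suffices to estimate
`|x \ y|`. Sample each position with probability `p = 1 / (2 a)` and give it one of about `b / a`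
random labels. If exactly one position of `x` is sampled, Alice sends its label, and Bob accepts if
no sampled position of `y` carries it. With `m` labels this happens with probability
`|x \ y| p (1 - p) ^ (a - 1) (1 - p / m) ^ |y \ x|`, so `η` is of order `g / a`, and the message
has length of order `log (b / a) + 1`. Finally `r² = O(r² log r + 1)` trades the extra `1` for
the term `log (a / g)`.
-/

section

open MeasureTheory ProbabilityTheory Finset
open scoped symmDiff

theorem DetProtocol.exists_oneWay {X Y : Type} (L : ℕ) (A : X → Fin L → Bool)
    (B : Y → (Fin L → Bool) → Bool) :
    ∃ P : DetProtocol X Y Bool, P.depth ≤ L + 1 ∧ ∀ x y, P.run x y = B y (A x) := by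
  induction L with
  | zero =>
    refine ⟨.bob (fun y => B y Fin.elim0) (.leaf false) (.leaf true), by simp [depth], ?_⟩
    intro x y
    have : A x = Fin.elim0 := Subsingleton.elim _ _
    simp [run, this]
  | succ L ih =>
    obtain ⟨P₀, h₀, hr₀⟩ := ih (fun x => Fin.tail (A x)) (fun y v => B y (Fin.cons false v))
    obtain ⟨P₁, h₁, hr₁⟩ := ih (fun x => Fin.tail (A x)) (fun y v => B y (Fin.cons true v))
    refine ⟨.alice (fun x => A x 0) P₀ P₁, by simp [depth, h₀, h₁], fun x y => ?_⟩
    have hc : Fin.cons (A x 0) (Fin.tail (A x)) = A x := Fin.cons_self_tail _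
    cases h : A x 0 <;> rw [h] at hc <;> simp [run, h, hr₀, hr₁, hc]

theorem DetProtocol.exists_oneWay_of_card_le {X Y : Type} {M : Type*} [Fintype M] {L : ℕ}
    (hM : Fintype.card M ≤ 2 ^ L) (A : X → M) (B : Y → M → Bool) :
    ∃ P : DetProtocol X Y Bool, P.depth ≤ L + 1 ∧ ∀ x y, P.run x y = B y (A x) := by
  obtain hX | ⟨⟨x₀⟩⟩ := isEmpty_or_nonempty X
  · exact ⟨.leaf true, by simp [depth], fun x => (hX.false x).elim⟩
  have : Nonempty M := ⟨A x₀⟩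
  obtain ⟨e⟩ : Nonempty (M ↪ (Fin L → Bool)) :=
    Function.Embedding.nonempty_of_card_le (by simpa using hM)
  obtain ⟨P, hdepth, hrun⟩ := exists_oneWay L (fun x => e (A x))
    (fun y v => B y (Function.invFun e v))
  refine ⟨P, hdepth, fun x y => ?_⟩
  rw [hrun, Function.leftInverse_invFun e.injective]

section PublicCoins

variable {X Y Z : Type} {f : X → Y → Option Z}

theorem randCC_le_of_computes {k : ℕ} {π : PublicCoinProtocol X Y Z} (hπ : π.Computes f)
    (hk : π.cost ≤ k) : randCC f ≤ k :=
  Nat.sInf_le ⟨π, hπ, hk⟩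

theorem randCC_le_of_measure {Ω : Type*} [MeasurableSpace Ω] [DiscreteMeasurableSpace Ω]
    [Countable Ω] (μ : Measure Ω) [IsProbabilityMeasure μ] {k : ℕ}
    (P : Ω → DetProtocol X Y Z) (hdepth : ∀ ω, (P ω).depth ≤ k)
    (hcorrect : ∀ x y z, f x y = some z → 2 / 3 ≤ μ.real {ω | (P ω).run x y = z}) :
    randCC f ≤ k := by
  refine randCC_le_of_computes (π := μ.toPMF.map P) (fun x y z hz => ?_) ?_
  · have hprob : PublicCoinProtocol.output (μ.toPMF.map P) x y z
        = μ {ω | (P ω).run x y = z} := by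
      rw [PublicCoinProtocol.output, PMF.map_comp, ← PMF.toOuterMeasure_apply_singleton,
        PMF.toOuterMeasure_map_apply, ← PMF.toMeasure_apply_eq_toOuterMeasure,
        Measure.toPMF_toMeasure]
      rfl
    rw [hprob, ← ofReal_measureReal]
    refine le_trans ?_ (ENNReal.ofReal_le_ofReal (hcorrect x y z hz))
    rw [ENNReal.ofReal_div_of_pos (by norm_num)]
    simp
  · refine iSup₂_le fun Q hQ => ?_
    rw [PMF.support_map] at hQ
    obtain ⟨ω, -, rfl⟩ := hQ
    exact_mod_cast hdepth ω

theorem randCC_eq_zero_of_subsingleton [Nonempty Z]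
    (h : ∀ x y x' y' z z', f x y = some z → f x' y' = some z' → z = z') : randCC f = 0 := by
  obtain ⟨z₀, hz₀⟩ : ∃ z₀, ∀ x y z, f x y = some z → z = z₀ := by
    by_cases hdef : ∃ x y z, f x y = some z
    · obtain ⟨x, y, z, hz⟩ := hdef
      exact ⟨z, fun x' y' z' hz' => h _ _ _ _ _ _ hz' hz⟩
    · exact ⟨Classical.arbitrary Z, fun x y z hz => (hdef ⟨x, y, z, hz⟩).elim⟩
  refine Nat.le_zero.mp (randCC_le_of_measure (Measure.dirac ()) (fun _ => .leaf z₀)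
    (fun _ => le_rfl) fun x y z hz => ?_)
  rw [hz₀ x y z hz]
  norm_num [DetProtocol.run]

theorem randCC_eq_zero_of_forall_ne {f : X → Y → Option Bool} (σ : Bool)
    (h : ∀ x y x' y', f x y = some σ → f x' y' ≠ some (!σ)) : randCC f = 0 := by
  refine randCC_eq_zero_of_subsingleton fun x y x' y' z z' hz hz' => ?_
  by_contra hne
  obtain ⟨rfl, rfl⟩ | ⟨rfl, rfl⟩ : z = σ ∧ z' = !σ ∨ z' = σ ∧ z = !σ := by
    cases z <;> cases z' <;> cases σ <;> simp_all
  exacts [h _ _ _ _ hz hz', h _ _ _ _ hz' hz]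

end PublicCoins

theorem exists_nat_mul_sq_mem_Icc {η : ℝ} (hη0 : 0 < η) (hη1 : η ≤ 1) :
    ∃ k : ℕ, k * η ^ 2 ∈ Set.Icc 3 4 := by
  refine ⟨⌈3 / η ^ 2⌉₊, (div_le_iff₀ (by positivity)).mp (Nat.le_ceil _), ?_⟩
  calc ⌈3 / η ^ 2⌉₊ * η ^ 2 ≤ (3 / η ^ 2 + 1) * η ^ 2 := by
        gcongr
        exact (Nat.ceil_lt_add_one (by positivity)).le
    _ = 3 + η ^ 2 := by field_simp
    _ ≤ 4 := by linarith [pow_le_one₀ (n := 2) hη0.le hη1]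

section Amplification

variable {Ω : Type*} [MeasurableSpace Ω] {μ : Measure Ω} [IsProbabilityMeasure μ]

theorem measureReal_pi_deviation_le {κ : Type*} [Fintype κ] [Nonempty κ] {E : Set Ω}
    [DecidablePred (· ∈ E)] (hE : MeasurableSet E) {δ : ℝ} (hδ : 0 < δ) :
    (Measure.pi fun _ : κ => μ).real
        {v | Fintype.card κ * δ ≤ |(#{j | v j ∈ E} : ℝ) - Fintype.card κ * μ.real E|} ≤
      1 / (4 * Fintype.card κ * δ ^ 2) := by
  set k : ℝ := (Fintype.card κ : ℝ)
  have hk : 0 < k := by simpa [k] using Fintype.card_pos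
  set ν := Measure.pi fun _ : κ => μ
  set I : Ω → ℝ := E.indicator 1
  have hI : Measurable I := measurable_one.indicator hE
  have hI_mem (ω : Ω) : I ω ∈ Set.Icc 0 1 := by
    by_cases hω : ω ∈ E <;> simp [I, hω]
  have hI_L2 : MemLp I 2 μ := memLp_of_bounded (.of_forall hI_mem) hI.aestronglyMeasurable 2
  set N : (κ → Ω) → ℝ := ∑ j, fun v => I (v j)
  have hcount (v : κ → Ω) : (#{j | v j ∈ E} : ℝ) = N v := by
    simp [N, I, Set.indicator_apply]
  have hN_L2 : MemLp N 2 ν := memLp_finsetSum' _ fun j _ =>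
    hI_L2.comp_measurePreserving (measurePreserving_eval (fun _ : κ => μ) j)
  have hmean : ν[N] = k * μ.real E := by
    have hint (j : κ) : ∫ v, I (v j) ∂ν = μ.real E := by
      rw [integral_comp_eval (μ := fun _ : κ => μ) hI.aestronglyMeasurable,
        integral_indicator_one hE]
    simp only [N, Finset.sum_apply]
    rw [integral_finsetSum _ fun j _ => integrable_comp_eval (hI_L2.integrable one_le_two)]
    rw [Finset.sum_congr rfl fun j _ => hint j]
    simp [k]
  have hvar : Var[N; ν] ≤ k / 4 := by
    have hI_var : Var[I; μ] ≤ ((1 - 0) / 2) ^ 2 :=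
      variance_le_sq_of_bounded (.of_forall hI_mem) hI.aemeasurable
    calc Var[N; ν] = ∑ _j : κ, Var[I; μ] := variance_sum_pi fun _ => hI_L2
      _ = k * Var[I; μ] := by simp [k]
      _ ≤ k / 4 := by nlinarith
  simp only [hcount]
  rw [← hmean]
  calc ν.real {v | k * δ ≤ |N v - ν[N]|} ≤ Var[N; ν] / (k * δ) ^ 2 := by
        refine ENNReal.toReal_le_of_le_ofReal
          (div_nonneg (variance_nonneg _ _) (sq_nonneg _)) ?_
        exact meas_ge_le_variance_div_sq hN_L2 (mul_pos hk hδ)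
    _ ≤ k / 4 / (k * δ) ^ 2 := by gcongr
    _ = 1 / (4 * k * δ ^ 2) := by field_simp

variable [DiscreteMeasurableSpace Ω] [Countable Ω] {X Y : Type} {f : X → Y → Option Bool}
  {M : Type*} [Fintype M] {s : ℕ}

theorem randCC_le_of_acceptance_threshold (hM : Fintype.card M ≤ 2 ^ s) (A : Ω → X → M)
    (B : Ω → Y → M → Prop) (σ : Bool) {k : ℕ} {θ δ : ℝ} (hδ : 0 < δ) (hk : 3 ≤ 4 * k * δ ^ 2)
    (haccept : ∀ x y, f x y = some σ → θ + δ ≤ μ.real {ω | B ω y (A ω x)})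
    (hreject : ∀ x y, f x y = some (!σ) → μ.real {ω | B ω y (A ω x)} ≤ θ - δ) :
    randCC f ≤ s * k + 1 := by
  classical
  have : Nonempty (Fin k) := Fin.pos_iff_nonempty.mp <| Nat.pos_of_ne_zero fun h => by
    norm_num [h] at hk
  have hMk : Fintype.card (Fin k → M) ≤ 2 ^ (s * k) := by
    simpa [pow_mul] using Nat.pow_le_pow_left hM k
  choose P hdepth hrun using fun v : Fin k → Ω => DetProtocol.exists_oneWay_of_card_le hMk
    (fun x j => A (v j) x)
    (fun y m => decide (k * θ ≤ #{j | B (v j) y (m j)}) == σ)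
  refine randCC_le_of_measure (Measure.pi fun _ => μ) P hdepth fun x y z hz => ?_
  set E : Set Ω := {ω | B ω y (A ω x)}
  set D : Set (Fin k → Ω) := {v | k * δ ≤ |(#{j | v j ∈ E} : ℝ) - k * μ.real E|}
  have hD : (Measure.pi fun _ : Fin k => μ).real D ≤ 1 / 3 := by
    have hle := measureReal_pi_deviation_le (κ := Fin k) (μ := μ)
      (.of_discrete : MeasurableSet E) hδ
    rw [Fintype.card_fin] at hle
    exact hle.trans (one_div_le_one_div_of_le (by norm_num) hk)
  have hcorrect : Dᶜ ⊆ {v | (P v).run x y = z} := by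
    intro v hv
    have hv' : |(#{j | v j ∈ E} : ℝ) - k * μ.real E| < k * δ := not_le.mp hv
    rw [abs_lt] at hv'
    change (P v).run x y = z
    rw [hrun]
    change (decide (k * θ ≤ #{j | v j ∈ E}) == σ) = z
    have hk0 : (0 : ℝ) ≤ k := k.cast_nonneg
    obtain rfl | rfl : z = σ ∨ z = !σ := by cases z <;> cases σ <;> simp
    · have := mul_le_mul_of_nonneg_left (haccept x y hz) hk0
      simp [show k * θ ≤ #{j | v j ∈ E} by linarith]
    · have := mul_le_mul_of_nonneg_left (hreject x y hz) hk0
      simp [show ¬ k * θ ≤ #{j | v j ∈ E} by linarith]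
  calc (2 / 3 : ℝ) ≤ (Measure.pi fun _ : Fin k => μ).real Dᶜ := by
        rw [probReal_compl_eq_one_sub .of_discrete]
        linarith
    _ ≤ _ := measureReal_mono hcorrect

theorem randCC_le_of_acceptance_gap (hM : Fintype.card M ≤ 2 ^ s) (A : Ω → X → M)
    (B : Ω → Y → M → Prop) (σ : Bool) {η : ℝ} (hη : 0 < η)
    (hgap : ∀ x y x' y', f x y = some σ → f x' y' = some (!σ) →
      μ.real {ω | B ω y' (A ω x')} + η ≤ μ.real {ω | B ω y (A ω x)}) :
    (randCC f : ℝ) ≤ (4 * s + 1) / η ^ 2 := by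
  by_cases hdef : ∃ x y x' y', f x y = some σ ∧ f x' y' = some (!σ)
  swap
  · push Not at hdef
    rw [randCC_eq_zero_of_forall_ne σ hdef, Nat.cast_zero]
    positivity
  obtain ⟨x₀, y₀, x₁, y₁, h₀, h₁⟩ := hdef
  have hη1 : η ≤ 1 := by
    have := hgap _ _ _ _ h₀ h₁
    have h0 : 0 ≤ μ.real {ω | B ω y₁ (A ω x₁)} := measureReal_nonneg
    have h1 : μ.real {ω | B ω y₀ (A ω x₀)} ≤ 1 := measureReal_le_one
    linarith
  obtain ⟨θ, hreject, haccept⟩ := exists_between_of_forall_le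
    (s := {t | ∃ x y, f x y = some (!σ) ∧ t = μ.real {ω | B ω y (A ω x)} + η / 2})
    (t := {t | ∃ x y, f x y = some σ ∧ t = μ.real {ω | B ω y (A ω x)} - η / 2})
    ⟨_, x₁, y₁, h₁, rfl⟩ ⟨_, x₀, y₀, h₀, rfl⟩ (by
      rintro _ ⟨x', y', h', rfl⟩ _ ⟨x, y, h, rfl⟩
      linarith [hgap x y x' y' h h'])
  obtain ⟨k, hk3, hk4⟩ := exists_nat_mul_sq_mem_Icc hη hη1
  have hcost := randCC_le_of_acceptance_threshold (μ := μ) (f := f) (θ := θ) hM A B σ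
    (half_pos hη) (by linarith : 3 ≤ 4 * k * (η / 2) ^ 2)
    (fun x y h => by linarith [haccept ⟨x, y, h, rfl⟩])
    (fun x y h => by linarith [hreject ⟨x, y, h, rfl⟩])
  rw [le_div_iff₀ (by positivity)]
  calc randCC f * η ^ 2 ≤ (s * k + 1) * η ^ 2 := by gcongr; exact_mod_cast hcost
    _ = s * (k * η ^ 2) + η ^ 2 := by ring
    _ ≤ s * 4 + 1 := by gcongr; exact pow_le_one₀ hη.le hη1
    _ = 4 * s + 1 := by ring

end Amplification

instance instMeasurableSingletonClassUnits {G : Type*} [Monoid G] [MeasurableSpace G]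
    [MeasurableSingletonClass G] : MeasurableSingletonClass Gˣ where
  measurableSet_singleton u :=
    ⟨{(u : G)}, measurableSet_singleton _, by ext; simp [Units.ext_iff]⟩

theorem min_mul_one_div_two_le_one_sub_pow {u : ℝ} (hu0 : 0 ≤ u) (hu1 : u ≤ 1) (d : ℕ) :
    min (d * u) 1 / 2 ≤ 1 - (1 - u) ^ d := by
  set t := min (d * u) 1
  have ht0 : 0 ≤ t := by positivity
  have ht1 : t ≤ 1 := min_le_right _ _
  have hpow : (1 - u) ^ d * (1 + t) ≤ 1 :=
    calc (1 - u) ^ d * (1 + t) ≤ (1 - u) ^ d * (1 + u) ^ d := by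
          gcongr
          exact (add_le_add_right (min_le_left _ _) 1).trans
            (one_add_mul_le_pow (by linarith) d)
      _ = (1 - u ^ 2) ^ d := by rw [← mul_pow]; ring
      _ ≤ 1 := pow_le_one₀ (by nlinarith) (by nlinarith)
  have : (1 - u) ^ d ≤ 1 - t / 2 := by
    refine le_of_mul_le_mul_right (hpow.trans ?_) (by positivity : 0 < 1 + t)
    nlinarith
  linarith

theorem integral_pi_bernoulli_prod {ι : Type*} [Fintype ι] (p : unitInterval) (s : Finset ι) :
    ∫ h, ((∏ i ∈ s, h i : ℤˣ) : ℝ) ∂(Measure.pi fun _ : ι => Ber(-1, 1, p)) =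
      (1 - 2 * p) ^ #s := by
  classical
  calc ∫ h, ((∏ i ∈ s, h i : ℤˣ) : ℝ) ∂(Measure.pi fun _ : ι => Ber(-1, 1, p))
      = ∫ h, ∏ i, (if i ∈ s then ((h i : ℤˣ) : ℝ) else 1)
          ∂(Measure.pi fun _ : ι => Ber(-1, 1, p)) := by simp [prod_ite_mem]
    _ = ∏ i, ∫ e, (if i ∈ s then ((e : ℤˣ) : ℝ) else 1) ∂Ber(-1, 1, p) :=
        integral_fintype_prod_eq_prod fun i (e : ℤˣ) => if i ∈ s then (e : ℝ) else 1
    _ = ∏ i, if i ∈ s then (1 - 2 * p : ℝ) else 1 := by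
        refine prod_congr rfl fun i _ => ?_
        rw [integral_bernoulliMeasure]
        split_ifs
        · push_cast [smul_eq_mul, unitInterval.coe_symm_eq]
          ring
        · simp
    _ = (1 - 2 * p) ^ #s := by simp

section SymmDiff

variable {ι : Type*} [DecidableEq ι]

theorem card_sdiff_add_card_comm (s t : Finset ι) : #(s \ t) + #t = #(t \ s) + #s := by
  rw [card_sdiff_add_card, card_sdiff_add_card, union_comm]

theorem card_symmDiff_add_card (s t : Finset ι) : #(s ∆ t) + #s = 2 * #(s \ t) + #t := by
  rw [symmDiff_def, sup_eq_union, card_union_of_disjoint disjoint_sdiff_sdiff, add_assoc,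
    ← card_sdiff_add_card_comm, ← add_assoc, two_mul]

theorem card_symmDiff_compl_add_card_symmDiff [Fintype ι] (s t : Finset ι) :
    #(s ∆ tᶜ) + #(s ∆ t) = Fintype.card ι := by
  have hcompl : s ∆ tᶜ = (s ∆ t)ᶜ := by
    ext i
    by_cases hs : i ∈ s <;> by_cases ht : i ∈ t <;> simp [mem_symmDiff, hs, ht]
  rw [hcompl, card_compl_add_card]

theorem prod_intUnits_symmDiff (h : ι → ℤˣ) (s t : Finset ι) :
    ∏ i ∈ s ∆ t, h i = (∏ i ∈ s, h i) * ∏ i ∈ t, h i := by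
  rw [symmDiff_def, sup_eq_union, prod_union disjoint_sdiff_sdiff,
    ← prod_inter_mul_prod_sdiff s t, ← prod_inter_mul_prod_sdiff t s, inter_comm t s,
    mul_mul_mul_comm, Int.units_mul_self, one_mul]

theorem measureReal_pi_bernoulli_prod_ne [Fintype ι] (p : unitInterval) (s t : Finset ι) :
    (Measure.pi fun _ : ι => Ber(-1, 1, p)).real {h : ι → ℤˣ | ∏ i ∈ s, h i ≠ ∏ i ∈ t, h i} =
      (1 - (1 - 2 * p) ^ #(s ∆ t)) / 2 := by
  set μ := Measure.pi fun _ : ι => Ber((-1 : ℤˣ), 1, p)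
  set E := {h : ι → ℤˣ | ∏ i ∈ s, h i ≠ ∏ i ∈ t, h i}
  have hprod (h : ι → ℤˣ) : ((∏ i ∈ s ∆ t, h i : ℤˣ) : ℝ) = 1 - 2 * E.indicator 1 h := by
    rw [prod_intUnits_symmDiff]
    by_cases hE : ∏ i ∈ s, h i = ∏ i ∈ t, h i
    · simp [E, hE, Int.units_mul_self]
    · rw [Set.indicator_of_mem (show h ∈ E from hE), Int.units_ne_iff_eq_neg.mp hE]
      norm_num [Int.units_mul_self]
  have hE : MeasurableSet E := .of_discrete
  have hint : Integrable (E.indicator 1 : (ι → ℤˣ) → ℝ) μ :=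
    (integrable_const 1).indicator hE
  have hmean := integral_pi_bernoulli_prod p (s ∆ t)
  simp_rw [hprod] at hmean
  rw [integral_sub (integrable_const 1) (hint.const_mul 2), integral_const_mul,
    integral_indicator_one hE, integral_const, probReal_univ, one_smul] at hmean
  linarith

end SymmDiff

theorem div_four_mul_le_pow_sub_pow {c g : ℝ} (hg : 1 ≤ g) {d d' : ℕ} (hd' : d' + g ≤ c)
    (hd : c + g ≤ d) :
    g / (4 * c) ≤ (1 - 1 / (2 * c)) ^ d' - (1 - 1 / (2 * c)) ^ d := by
  have hc : 1 ≤ c := by linarith [d'.cast_nonneg (α := ℝ)]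
  set u := 1 / (2 * c)
  have hu0 : 0 ≤ u := by positivity
  have hu1 : u ≤ 1 / 2 := one_div_le_one_div_of_le two_pos (by linarith)
  have hcu : c * u = 1 / 2 := by simp only [u]; field_simp
  obtain ⟨e, rfl⟩ : ∃ e, d = d' + e :=
    Nat.exists_eq_add_of_le (by exact_mod_cast (show (d' : ℝ) ≤ d by linarith))
  have he : g / c ≤ min (e * u) 1 := by
    push_cast at hd
    refine le_min ?_ ((div_le_one (by linarith)).mpr (by linarith [d'.cast_nonneg (α := ℝ)]))
    calc g / c = 2 * g * u := by simp only [u]; field_simp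
      _ ≤ e * u := by gcongr; linarith
  have hgap := min_mul_one_div_two_le_one_sub_pow hu0 (by linarith) e
  have hpow : 1 / 2 ≤ (1 - u) ^ d' := by
    have hbern := one_add_mul_le_pow (a := -u) (by linarith) d'
    have hd'u : d' * u ≤ c * u := by gcongr; linarith
    rw [← sub_eq_add_neg] at hbern
    linarith
  calc g / (4 * c) = 1 / 2 * (g / c / 2) := by ring
    _ ≤ (1 - u) ^ d' * (1 - (1 - u) ^ e) := by gcongr; linarith
    _ = (1 - u) ^ d' - (1 - u) ^ (d' + e) := by ring

theorem randCC_le_of_card_symmDiff_gap {ι : Type*} [Finite ι] [DecidableEq ι] {X Y : Type}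
    {f : X → Y → Option Bool} (S : X → Finset ι) (T : Y → Finset ι) (σ : Bool) {c g : ℝ}
    (hg : 1 ≤ g) (hfar : ∀ x y, f x y = some σ → c + g ≤ #(S x ∆ T y))
    (hnear : ∀ x y, f x y = some (!σ) → #(S x ∆ T y) + g ≤ c) :
    (randCC f : ℝ) ≤ 320 * (c / g) ^ 2 := by
  obtain hcg | hgc := lt_or_ge c g
  · have hzero : randCC f = 0 := randCC_eq_zero_of_forall_ne σ fun _ _ x y _ h => by
      linarith [hnear x y h, (#(S x ∆ T y)).cast_nonneg (α := ℝ)]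
    rw [hzero, Nat.cast_zero]
    positivity
  have := Fintype.ofFinite ι
  have hc : 0 < c := by linarith
  let p : unitInterval :=
    ⟨1 / (4 * c), by positivity, (div_le_one (by positivity)).mpr (by linarith)⟩
  have hp : 1 - 2 * (p : ℝ) = 1 - 1 / (2 * c) := by
    simp only [p]
    ring
  have hcost := randCC_le_of_acceptance_gap (f := f) (s := 1) (M := ℤˣ) (η := g / (8 * c))
    (μ := Measure.pi fun _ : ι => Ber(-1, 1, p)) (by simp) (fun h x => ∏ i ∈ S x, h i)
    (fun h y m => m ≠ ∏ i ∈ T y, h i) σ (by positivity) fun x y x' y' hxy hxy' => by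
      rw [measureReal_pi_bernoulli_prod_ne, measureReal_pi_bernoulli_prod_ne, hp]
      have hgap := div_four_mul_le_pow_sub_pow hg (hnear x' y' hxy') (hfar x y hxy)
      have : g / (8 * c) = g / (4 * c) / 2 := by ring
      linarith
  calc (randCC f : ℝ) ≤ (4 * (1 : ℕ) + 1) / (g / (8 * c)) ^ 2 := hcost
    _ = 320 * (c / g) ^ 2 := by
      field_simp
      norm_num

section IsolatedLabel

variable {ι β : Type*}

/-- Alice's message on the set `s` when `h i = (true, l)` says that the point `i` is sampled and
labelled `l`: the label of the only sampled point of `s`, or `none` if `s` does not contain exactly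
one sampled point. -/
noncomputable def isolatedLabel (h : ι → Bool × β) (s : Finset ι) : Option β :=
  open Classical in
  if hs : ∃! i, i ∈ s ∧ (h i).1 = true then some (h hs.choose).2 else none

/-- Bob's test on the set `t`: the message is a label, and no sampled point of `t` carries it. -/
def IsMissedLabel (h : ι → Bool × β) (t : Finset ι) (m : Option β) : Prop :=
  ∃ l, m = some l ∧ ∀ j ∈ t, h j ≠ (true, l)

theorem isolatedLabel_eq_some_iff {h : ι → Bool × β} {s : Finset ι} {l : β} :
    isolatedLabel h s = some l ↔
      ∃ i ∈ s, h i = (true, l) ∧ ∀ j ∈ s, j ≠ i → (h j).1 = false := by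
  rw [isolatedLabel, Option.dite_none_right_eq_some]
  constructor
  · rintro ⟨hs, hl⟩
    obtain ⟨⟨hmem, hsampled⟩, hunique⟩ := hs.choose_spec
    refine ⟨_, hmem, Prod.ext hsampled (Option.some_inj.mp hl), fun j hj hne => ?_⟩
    exact Bool.eq_false_of_not_eq_true fun hj' => hne (hunique j ⟨hj, hj'⟩)
  · rintro ⟨i, hi, hil, hother⟩
    have hs : ∃! i, i ∈ s ∧ (h i).1 = true := by
      refine ⟨i, ⟨hi, by rw [hil]⟩, fun j ⟨hj, hj'⟩ => ?_⟩
      by_contra hne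
      simp [hother j hj hne] at hj'
    have hchoose : hs.choose = i := hs.unique hs.choose_spec.1 ⟨hi, by rw [hil]⟩
    exact ⟨hs, by rw [hchoose, hil]⟩

variable [DecidableEq ι]

/-- The event that, among the points of `s ∪ t`, the point `i` is sampled with label `l`, no other
point of `s` is sampled and no point of `t` outside `s` has label `l`; it is a box. -/
def isolationBox (s t : Finset ι) (i : ι) (l : β) : Set (ι → Bool × β) :=
  Set.univ.pi fun j =>
    if j ∈ s then if j = i then {(true, l)} else Prod.fst ⁻¹' {false}
    else if j ∈ t then {(true, l)}ᶜ else Set.univ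

theorem mem_isolationBox {s t : Finset ι} {i : ι} (hi : i ∈ s) {l : β} {h : ι → Bool × β} :
    h ∈ isolationBox s t i l ↔ h i = (true, l) ∧ (∀ j ∈ s, j ≠ i → (h j).1 = false) ∧
      ∀ j ∈ t \ s, h j ≠ (true, l) := by
  simp only [isolationBox, Set.mem_univ_pi, mem_sdiff]
  constructor
  · intro hbox
    refine ⟨by simpa [hi] using hbox i, fun j hj hji => by simpa [hj, hji] using hbox j,
      fun j hj => by simpa [hj] using hbox j⟩
  · rintro ⟨hil, hs, ht⟩ j
    split_ifs with hjs hji hjt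
    · simp [hji, hil]
    · simpa using hs j hjs hji
    · simpa using ht j ⟨hjt, hjs⟩
    · trivial

theorem setOf_isMissedLabel_isolatedLabel [Fintype β] (s t : Finset ι) :
    {h : ι → Bool × β | IsMissedLabel h t (isolatedLabel h s)} =
      ⋃ q ∈ (s \ t) ×ˢ (univ : Finset β), isolationBox s t q.1 q.2 := by
  ext h
  simp only [Set.mem_ofPred_eq, IsMissedLabel, isolatedLabel_eq_some_iff, Set.mem_iUnion,
    mem_product, mem_univ, and_true, exists_prop, Prod.exists]
  constructor
  · rintro ⟨l, ⟨i, hi, hil, hs⟩, ht⟩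
    have hit : i ∉ t := fun hit => ht i hit hil
    exact ⟨i, l, mem_sdiff.mpr ⟨hi, hit⟩, (mem_isolationBox hi).mpr
      ⟨hil, hs, fun j hj => ht j (mem_sdiff.mp hj).1⟩⟩
  · rintro ⟨i, l, hi, hbox⟩
    obtain ⟨his, hit⟩ := mem_sdiff.mp hi
    obtain ⟨hil, hs, ht⟩ := (mem_isolationBox his).mp hbox
    refine ⟨l, ⟨i, his, hil, hs⟩, fun j hj hjl => ?_⟩
    by_cases hjs : j ∈ s
    · have hji : j ≠ i := fun hji => hit (hji ▸ hj)
      simpa [hjl] using hs j hjs hji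
    · exact ht j (mem_sdiff.mpr ⟨hj, hjs⟩) hjl

theorem pairwiseDisjoint_isolationBox (s t : Finset ι) :
    ({q : ι × β | q.1 ∈ s}).PairwiseDisjoint fun q => isolationBox s t q.1 q.2 := by
  rintro ⟨i, l⟩ hi ⟨i', l'⟩ hi' hne
  refine Set.disjoint_left.mpr fun h hbox hbox' => hne ?_
  obtain ⟨hil, hs, -⟩ := (mem_isolationBox hi).mp hbox
  obtain ⟨hil', -⟩ := (mem_isolationBox hi').mp hbox'
  obtain rfl : i' = i := by
    by_contra hii
    simpa [hil'] using hs i' hi' hii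
  rw [hil] at hil'
  simpa using hil'

/-- The law of the pair (sampled or not, label) of a single point: it is sampled with probability
`p`, and its label is independent of this and uniform. -/
noncomputable def sampledLabelLaw (β : Type*) [MeasurableSpace β] (p : unitInterval) :
    Measure (Bool × β) :=
  Ber(true, false, p).prod (uniformOn Set.univ)

variable [MeasurableSpace β]

theorem sampledLabelLaw_real_singleton [Fintype β] [MeasurableSingletonClass β]
    (p : unitInterval) (l : β) : (sampledLabelLaw β p).real {(true, l)} = p / Fintype.card β := by
  have hlabel : (uniformOn Set.univ : Measure β).real {l} = 1 / Fintype.card β := by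
    simp [measureReal_def, uniformOn_univ]
  rw [← Set.singleton_prod_singleton, sampledLabelLaw, measureReal_prod_prod, hlabel]
  simp [div_eq_mul_inv]

instance [Finite β] [Nonempty β] (p : unitInterval) :
    IsProbabilityMeasure (sampledLabelLaw β p) := by
  unfold sampledLabelLaw
  infer_instance

theorem sampledLabelLaw_real_fst_preimage [Finite β] [Nonempty β] (p : unitInterval) :
    (sampledLabelLaw β p).real (Prod.fst ⁻¹' {false}) = 1 - p := by
  rw [← Set.prod_univ, sampledLabelLaw, measureReal_prod_prod]
  simp

variable [Fintype ι] [Fintype β] [Nonempty β] [MeasurableSingletonClass β]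

theorem measureReal_isolationBox (p : unitInterval) {s t : Finset ι} {i : ι} (hi : i ∈ s)
    (l : β) :
    (Measure.pi fun _ : ι => sampledLabelLaw β p).real (isolationBox s t i l) =
      p / Fintype.card β * (1 - p) ^ (#s - 1) * (1 - p / Fintype.card β) ^ #(t \ s) := by
  set ν := sampledLabelLaw β p
  rw [isolationBox, measureReal_def, Measure.pi_pi, ENNReal.toReal_prod]
  calc ∏ j, ν.real (if j ∈ s then if j = i then {(true, l)} else Prod.fst ⁻¹' {false}
        else if j ∈ t then {(true, l)}ᶜ else Set.univ)
      = ∏ j, ((if j = i then (p / Fintype.card β : ℝ) else 1) *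
          (if j ∈ s.erase i then (1 - p : ℝ) else 1) *
          (if j ∈ t \ s then (1 - p / Fintype.card β : ℝ) else 1)) := by
        refine prod_congr rfl fun j _ => ?_
        have hcompl : ν.real {(true, l)}ᶜ = 1 - p / Fintype.card β := by
          rw [probReal_compl_eq_one_sub .of_discrete, sampledLabelLaw_real_singleton]
        split_ifs <;>
          simp_all [ν, sampledLabelLaw_real_singleton, sampledLabelLaw_real_fst_preimage]
    _ = _ := by
        simp only [prod_mul_distrib, prod_ite_eq', prod_ite_mem, univ_inter, prod_const,
          card_erase_of_mem hi, mem_univ, if_true]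

theorem measureReal_isMissedLabel_isolatedLabel (p : unitInterval) (s t : Finset ι) :
    (Measure.pi fun _ : ι => sampledLabelLaw β p).real
        {h | IsMissedLabel h t (isolatedLabel h s)} =
      #(s \ t) * (p * (1 - p) ^ (#s - 1) * (1 - p / Fintype.card β) ^ #(t \ s)) := by
  have hmem {q : ι × β} (hq : q ∈ (s \ t) ×ˢ (univ : Finset β)) : q.1 ∈ s :=
    (mem_sdiff.mp (mem_product.mp hq).1).1
  rw [setOf_isMissedLabel_isolatedLabel, measureReal_biUnion_finset
    ((pairwiseDisjoint_isolationBox s t).subset fun q hq => hmem hq) fun _ _ => .of_discrete,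
    sum_congr rfl fun q hq => measureReal_isolationBox p (hmem hq) q.2, sum_const, card_product,
    card_univ, nsmul_eq_mul, Nat.cast_mul]
  field_simp

theorem one_div_four_mul_le_mul_pow {a : ℕ} (ha : 0 < a) :
    1 / (4 * a) ≤ 1 / (2 * a : ℝ) * (1 - 1 / (2 * a)) ^ (a - 1) := by
  have ha1 : (1 : ℝ) ≤ a := by exact_mod_cast ha
  have hbern := one_add_mul_le_pow (a := -(1 / (2 * a : ℝ)))
    (by linarith [one_div_le_one_div_of_le two_pos (by linarith : (2 : ℝ) ≤ 2 * a)]) (a - 1)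
  have hhalf : ((a - 1 : ℕ) : ℝ) * (1 / (2 * a)) ≤ 1 / 2 := by
    rw [Nat.cast_pred ha, mul_one_div, div_le_div_iff₀ (by positivity) two_pos]
    linarith
  calc 1 / (4 * a) = 1 / (2 * a : ℝ) * (1 / 2) := by ring
    _ ≤ _ := by
      rw [← sub_eq_add_neg] at hbern
      gcongr
      linarith

theorem div_four_le_mul_pow_sub_mul_pow {q : ℝ} (hq : 0 ≤ q) {u w d : ℕ}
    (hu : q * (u + d) ≤ 1 / 2) (hw : q * w ≤ 1 / 2) :
    d / 4 ≤ (u + d) * (1 - q) ^ (w + d) - u * (1 - q) ^ w := by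
  obtain rfl | hd := d.eq_zero_or_pos
  · simp
  have hd1 : (1 : ℝ) ≤ d := by exact_mod_cast hd
  have hq1 : 0 ≤ 1 - q := by nlinarith [u.cast_nonneg (α := ℝ)]
  have hbern (k : ℕ) : 1 - k * q ≤ (1 - q) ^ k := by
    simpa [sub_eq_add_neg] using one_add_mul_le_pow (a := -q) (by linarith) k
  calc (d / 4 : ℝ) = 1 / 2 * (d * (1 / 2)) := by ring
    _ ≤ (1 - q) ^ w * (d * (1 - q * (u + d))) := by
        gcongr
        · linarith [hbern w]
        · linarith
    _ = (1 - q) ^ w * ((u + d) * (1 - d * q) - u) := by ring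
    _ ≤ (1 - q) ^ w * ((u + d) * (1 - q) ^ d - u) := by
        gcongr
        exact hbern d
    _ = (u + d) * (1 - q) ^ (w + d) - u * (1 - q) ^ w := by ring

theorem measureReal_isMissedLabel_gap {a b : ℕ} (ha : 0 < a) (hb : b ≤ a * Fintype.card β)
    {p : unitInterval} (hp : (p : ℝ) = 1 / (2 * a)) {g : ℝ} (hg : 0 < g) {s t s' t' : Finset ι}
    (hs : #s = a) (ht : #t = b) (hs' : #s' = a) (ht' : #t' = b)
    (hgap : #(s' \ t') + g ≤ #(s \ t)) :
    (Measure.pi fun _ : ι => sampledLabelLaw β p).real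
        {h | IsMissedLabel h t' (isolatedLabel h s')} + g / (16 * a) ≤
      (Measure.pi fun _ : ι => sampledLabelLaw β p).real
        {h | IsMissedLabel h t (isolatedLabel h s)} := by
  obtain ⟨d, hd⟩ : ∃ d, #(s \ t) = #(s' \ t') + d := Nat.exists_eq_add_of_le
    (by exact_mod_cast (show (#(s' \ t') : ℝ) ≤ #(s \ t) by linarith))
  have hdt : #(t \ s) = #(t' \ s') + d := by
    have := card_sdiff_add_card_comm s t
    have := card_sdiff_add_card_comm s' t'
    omega
  have hm : (1 : ℝ) ≤ Fintype.card β := by exact_mod_cast Fintype.card_pos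
  set q : ℝ := p / Fintype.card β
  have hq0 : 0 ≤ q := div_nonneg p.2.1 (Nat.cast_nonneg _)
  have hq_le {k : ℕ} (hk : k ≤ a * Fintype.card β) : q * k ≤ 1 / 2 :=
    calc q * k ≤ q * (a * Fintype.card β) := by gcongr; exact_mod_cast hk
      _ = 1 / 2 := by simp only [q, hp]; field_simp
  have hlin : d / 4 ≤ (#(s' \ t') + d) * (1 - q) ^ (#(t' \ s') + d) -
      #(s' \ t') * (1 - q) ^ #(t' \ s') := by
    have hu : #(s' \ t') + d ≤ a * Fintype.card β := by
      rw [← hd]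
      exact (card_le_card sdiff_subset).trans
        (hs.le.trans (Nat.le_mul_of_pos_right a Fintype.card_pos))
    refine div_four_le_mul_pow_sub_mul_pow hq0 (by exact_mod_cast hq_le hu) (hq_le ?_)
    exact (card_le_card sdiff_subset).trans (ht'.le.trans hb)
  have hisolated : 1 / (4 * a) ≤ (p : ℝ) * (1 - p) ^ (a - 1) := by
    rw [hp]
    exact one_div_four_mul_le_mul_pow ha
  have hisolated0 : 0 ≤ (p : ℝ) * (1 - p) ^ (a - 1) :=
    le_trans (by positivity) hisolated
  rw [measureReal_isMissedLabel_isolatedLabel, measureReal_isMissedLabel_isolatedLabel, hs, hs',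
    hd, hdt]
  rw [hd] at hgap
  push_cast at hgap ⊢
  have hscaled : g / (16 * a) ≤ (p : ℝ) * (1 - p) ^ (a - 1) * (d / 4) :=
    calc g / (16 * a) = 1 / (4 * a) * (g / 4) := by ring
      _ ≤ _ := by gcongr; linarith
  linear_combination hscaled + mul_le_mul_of_nonneg_left hlin hisolated0

end IsolatedLabel

theorem logb_natCast_div_nonneg {a b : ℕ} (hab : a ≤ b) : 0 ≤ Real.logb 2 ((b : ℝ) / a) := by
  obtain rfl | ha := a.eq_zero_or_pos
  · simp
  · exact Real.logb_nonneg one_lt_two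
      ((one_le_div (by exact_mod_cast ha)).mpr (by exact_mod_cast hab))

section Sdiff

variable {ι : Type*} [Finite ι] [DecidableEq ι] {X Y : Type} {f : X → Y → Option Bool}
  {S : X → Finset ι} {T : Y → Finset ι} {σ : Bool} {a b : ℕ} {g : ℝ}

theorem randCC_le_of_card_sdiff_gap_of_labels {m s : ℕ} (ha : 0 < a) (hm : 0 < m)
    (hbm : b ≤ a * m) (hms : m + 1 ≤ 2 ^ s) (hg : 0 < g)
    (hcard : ∀ x y z, f x y = some z → #(S x) = a ∧ #(T y) = b)
    (hgap : ∀ x y x' y', f x y = some σ → f x' y' = some (!σ) →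
      #(S x' \ T y') + g ≤ #(S x \ T y)) :
    (randCC f : ℝ) ≤ 256 * (4 * s + 1) * (a / g) ^ 2 := by
  have := Fintype.ofFinite ι
  have : Nonempty (Fin m) := Fin.pos_iff_nonempty.mp hm
  have ha1 : (1 : ℝ) ≤ a := by exact_mod_cast ha
  let p : unitInterval :=
    ⟨1 / (2 * a), by positivity, (div_le_one (by positivity)).mpr (by linarith)⟩
  have hcost := randCC_le_of_acceptance_gap (f := f) (M := Option (Fin m)) (η := g / (16 * a))
    (μ := Measure.pi fun _ : ι => sampledLabelLaw (Fin m) p) (by simpa using hms)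
    (fun h x => isolatedLabel h (S x)) (fun h y => IsMissedLabel h (T y)) σ (by positivity)
    fun x y x' y' hxy hxy' => by
      obtain ⟨hS, hT⟩ := hcard x y _ hxy
      obtain ⟨hS', hT'⟩ := hcard x' y' _ hxy'
      exact measureReal_isMissedLabel_gap ha (by simpa using hbm) rfl hg hS hT hS' hT'
        (hgap x y x' y' hxy hxy')
  calc (randCC f : ℝ) ≤ (4 * s + 1) / (g / (16 * a)) ^ 2 := hcost
    _ = 256 * (4 * s + 1) * (a / g) ^ 2 := by
      field_simp
      norm_num

theorem exists_label_count (ha : 0 < a) (hab : a ≤ b) :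
    ∃ m s : ℕ, 0 < m ∧ b ≤ a * m ∧ m + 1 ≤ 2 ^ s ∧ (s : ℝ) ≤ Real.logb 2 (b / a) + 3 := by
  have ha' : (0 : ℝ) < a := by exact_mod_cast ha
  set r : ℝ := b / a with hr
  have hr1 : 1 ≤ r := (one_le_div ha').mpr (by exact_mod_cast hab)
  set L := Real.logb 2 r
  have hL : 0 ≤ L := logb_natCast_div_nonneg hab
  refine ⟨⌈r⌉₊, ⌈L⌉₊ + 2, Nat.ceil_pos.mpr (by linarith), ?_, ?_, ?_⟩
  · have : (b : ℝ) ≤ a * ⌈r⌉₊ :=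
      calc (b : ℝ) = a * r := by rw [hr]; field_simp
        _ ≤ a * ⌈r⌉₊ := by gcongr; exact Nat.le_ceil r
    exact_mod_cast this
  · have hpow : r ≤ 2 ^ ⌈L⌉₊ := by
      rw [← Real.rpow_natCast, ← Real.logb_le_iff_le_rpow one_lt_two (by linarith)]
      exact Nat.le_ceil L
    have : (⌈r⌉₊ + 1 : ℝ) ≤ 2 ^ (⌈L⌉₊ + 2) := by
      rw [pow_add]
      linarith [Nat.ceil_lt_add_one (by linarith : 0 ≤ r)]
    exact_mod_cast this
  · push_cast
    linarith [Nat.ceil_lt_add_one hL]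

theorem randCC_le_of_card_sdiff_gap (hab : a ≤ b) (hg : 0 < g)
    (hcard : ∀ x y z, f x y = some z → #(S x) = a ∧ #(T y) = b)
    (hgap : ∀ x y x' y', f x y = some σ → f x' y' = some (!σ) →
      #(S x' \ T y') + g ≤ #(S x \ T y)) :
    (randCC f : ℝ) ≤ 3328 * ((a / g) ^ 2 * (Real.logb 2 (b / a) + 1)) := by
  obtain rfl | ha := a.eq_zero_or_pos
  · have hzero : randCC f = 0 := randCC_eq_zero_of_forall_ne σ fun x y x' y' hxy hxy' => by
      have hS : S x = ∅ := card_eq_zero.mp (hcard x y _ hxy).1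
      have := hgap x y x' y' hxy hxy'
      rw [hS, empty_sdiff, card_empty, Nat.cast_zero] at this
      linarith [(#(S x' \ T y')).cast_nonneg (α := ℝ)]
    simp [hzero]
  obtain ⟨m, s, hm, hbm, hms, hs⟩ := exists_label_count ha hab
  have hL := logb_natCast_div_nonneg hab
  calc (randCC f : ℝ) ≤ 256 * (4 * s + 1) * (a / g) ^ 2 :=
        randCC_le_of_card_sdiff_gap_of_labels ha hm hbm hms hg hcard hgap
    _ ≤ 256 * (13 * (Real.logb 2 (b / a) + 1)) * (a / g) ^ 2 := by
        gcongr
        linarith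
    _ = 3328 * ((a / g) ^ 2 * (Real.logb 2 (b / a) + 1)) := by ring

end Sdiff

section GapHammingDistance

variable {n : ℕ}

/-- The set of positions at which a binary string is `1`. -/
def oneSet (x : Fin n → Bool) : Finset (Fin n) := {i | x i = true}

theorem hammingDist_eq_card_symmDiff_oneSet (x y : Fin n → Bool) :
    hammingDist x y = #(oneSet x ∆ oneSet y) := by
  refine congrArg card (Finset.ext fun i => ?_)
  cases hx : x i <;> cases hy : y i <;> simp [oneSet, mem_symmDiff, hx, hy]

variable {a b : ℕ} {c g : ℤ} {x y : Fin n → Bool}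

theorem card_oneSet_of_GHD_eq_some {z : Bool} (h : GHD n a b c g x y = some z) :
    #(oneSet x) = a ∧ #(oneSet y) = b := by
  unfold GHD at h
  split_ifs at h <;> assumption

theorem le_hammingDist_of_GHD_eq_some_true (h : GHD n a b c g x y = some true) :
    c + g ≤ hammingDist x y := by
  unfold GHD at h
  split_ifs at h <;> simp_all

theorem hammingDist_le_of_GHD_eq_some_false (h : GHD n a b c g x y = some false) :
    hammingDist x y ≤ c - g := by
  unfold GHD at h
  split_ifs at h <;> simp_all

variable (n a b c)

theorem randCC_GHD_le_of_weights (hab : a ≤ b) (hg : 0 < g) :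
    (randCC (GHD n a b c g) : ℝ) ≤
      3328 * (((a : ℝ) / g) ^ 2 * (Real.logb 2 ((b : ℝ) / a) + 1)) := by
  refine randCC_le_of_card_sdiff_gap (S := oneSet) (T := oneSet) (σ := true) hab
    (by exact_mod_cast hg) (fun x y z => card_oneSet_of_GHD_eq_some) fun x y x' y' h h' => ?_
  have hfar := le_hammingDist_of_GHD_eq_some_true h
  have hnear := hammingDist_le_of_GHD_eq_some_false h'
  rw [hammingDist_eq_card_symmDiff_oneSet] at hfar hnear
  obtain ⟨hx, hy⟩ := card_oneSet_of_GHD_eq_some h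
  obtain ⟨hx', hy'⟩ := card_oneSet_of_GHD_eq_some h'
  have := card_symmDiff_add_card (oneSet x) (oneSet y)
  have := card_symmDiff_add_card (oneSet x') (oneSet y')
  have : (#(oneSet x' \ oneSet y') : ℤ) + g ≤ #(oneSet x \ oneSet y) := by omega
  exact_mod_cast this

theorem randCC_GHD_le_of_distance (hg : 0 < g) :
    (randCC (GHD n a b c g) : ℝ) ≤ 320 * ((c : ℝ) / g) ^ 2 := by
  refine randCC_le_of_card_symmDiff_gap oneSet oneSet true (by exact_mod_cast hg)
    (fun x y h => ?_) fun x y h => ?_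
  · have hfar := le_hammingDist_of_GHD_eq_some_true h
    rw [hammingDist_eq_card_symmDiff_oneSet] at hfar
    exact_mod_cast hfar
  · have hnear := hammingDist_le_of_GHD_eq_some_false h
    rw [hammingDist_eq_card_symmDiff_oneSet] at hnear
    have : (#(oneSet x ∆ oneSet y) : ℤ) + g ≤ c := by linarith
    exact_mod_cast this

theorem randCC_GHD_le_of_codistance (hg : 0 < g) :
    (randCC (GHD n a b c g) : ℝ) ≤ 320 * (((n : ℝ) - c) / g) ^ 2 := by
  refine randCC_le_of_card_symmDiff_gap oneSet (fun y => (oneSet y)ᶜ) false (by exact_mod_cast hg)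
    (fun x y h => ?_) fun x y h => ?_
  all_goals
    have hcompl := card_symmDiff_compl_add_card_symmDiff (oneSet x) (oneSet y)
    rw [← hammingDist_eq_card_symmDiff_oneSet, Fintype.card_fin] at hcompl
  · have hnear := hammingDist_le_of_GHD_eq_some_false h
    have : (n : ℤ) - c + g ≤ #(oneSet x ∆ (oneSet y)ᶜ) := by omega
    exact_mod_cast this
  · have hfar := le_hammingDist_of_GHD_eq_some_true h
    have : (#(oneSet x ∆ (oneSet y)ᶜ) : ℤ) + g ≤ n - c := by omega
    exact_mod_cast this

end GapHammingDistance

theorem sq_le_four_mul_sq_mul_logb_add_one {r : ℝ} (hr : 0 ≤ r) :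
    r ^ 2 ≤ 4 * (r ^ 2 * Real.logb 2 r + 1) := by
  obtain rfl | hr := hr.eq_or_lt
  · simp
  have hlog2 : 1 / 2 < Real.log 2 := by linarith [Real.log_two_gt_d9]
  have hlog2' : Real.log 2 < 1 := by linarith [Real.log_two_lt_d9]
  have hlog : r ^ 2 - 1 ≤ r ^ 2 * (2 * Real.log r) :=
    calc r ^ 2 - 1 = r ^ 2 * (1 - (r ^ 2)⁻¹) := by field_simp
      _ ≤ r ^ 2 * Real.log (r ^ 2) := by
          gcongr
          exact Real.one_sub_inv_le_log_of_pos (by positivity)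
      _ = r ^ 2 * (2 * Real.log r) := by rw [Real.log_pow, Nat.cast_ofNat]
  refine le_of_mul_le_mul_right ?_ (by linarith : 0 < Real.log 2)
  calc r ^ 2 * Real.log 2 ≤ r ^ 2 * 1 := by gcongr
    _ ≤ 4 * (r ^ 2 * Real.log r + Real.log 2) := by nlinarith [sq_nonneg r]
    _ = 4 * (r ^ 2 * Real.logb 2 r + 1) * Real.log 2 := by
        rw [← Real.log_div_log]
        field_simp

theorem sq_mul_add_one_le_four_mul {r L : ℝ} (hr : 0 ≤ r) (hL : 0 ≤ L) :
    r ^ 2 * (L + 1) ≤ 4 * (r ^ 2 * (L + Real.logb 2 r) + 1) := by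
  have hrL : 0 ≤ r ^ 2 * L := by positivity
  linarith [sq_le_four_mul_sq_mul_logb_add_one hr]

end

theorem mainTheorem6_general :
    ∃ C : ℝ, 0 < C ∧ ∀ (n a b : ℕ) (c g : ℤ), 0 < g →
      (a ≤ b → (randCC (GHD n a b c g) : ℝ) ≤
          C * (((a : ℝ) / g) ^ 2 * (Real.logb 2 ((b : ℝ) / a) + 1))) ∧
      (randCC (GHD n a b c g) : ℝ) ≤
          C * min (((c : ℝ) / g) ^ 2) ((((n : ℝ) - c) / g) ^ 2) := by
  refine ⟨3328, by norm_num, fun n a b c g hg =>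
    ⟨fun hab => randCC_GHD_le_of_weights n a b c hab hg, ?_⟩⟩
  calc (randCC (GHD n a b c g) : ℝ)
      ≤ 320 * min (((c : ℝ) / g) ^ 2) ((((n : ℝ) - c) / g) ^ 2) := by
        rw [mul_min_of_nonneg _ _ (by norm_num)]
        exact le_min (randCC_GHD_le_of_distance n a b c hg)
          (randCC_GHD_le_of_codistance n a b c hg)
    _ ≤ _ := by gcongr; norm_num

theorem mainTheorem6 :
    ∃ C : ℝ, 0 < C ∧ ∀ (n a b : ℕ) (c g : ℤ), a ≤ b → 2 * b ≤ n → 0 < g →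
      (randCC (GHD n a b c g) : ℝ) ≤
          C * (((a : ℝ) / g) ^ 2 *
            (Real.logb 2 ((b : ℝ) / a) + Real.logb 2 ((a : ℝ) / g)) + 1) ∧
      (randCC (GHD n a b c g) : ℝ) ≤
          C * min (((c : ℝ) / g) ^ 2) ((((n : ℝ) - c) / g) ^ 2) := by
  obtain ⟨C, hC, hbound⟩ := mainTheorem6_general
  refine ⟨C * 4, by positivity, fun n a b c g hab _ hg => ⟨?_, ?_⟩⟩
  · refine ((hbound n a b c g hg).1 hab).trans ?_
    rw [mul_assoc]
    exact mul_le_mul_of_nonneg_left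
      (sq_mul_add_one_le_four_mul (by positivity) (logb_natCast_div_nonneg hab)) hC.le
  · refine (hbound n a b c g hg).2.trans ?_
    gcongr
    linarith
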